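/- For an open set $U\subset\mathbb{R}^2$ let $H^1(U)$ be the space of real-valued $u\in L^2(U)$ with weak gradient $\nabla u\in L^2(U;\mathbb{R}^2)$, a Hilbert space with the inner product $\int_U uv+\int_U\nabla u\cdot\nabla v$, and let $H^1_0(U)$ be the closure of $C_c^\infty(U)$ in $H^1(U)$. Elements of $H^1_0(U)$ are extended by zero outside $U$. Let $\Omega$, $\Omega_1$, $\Omega_2$ be one of the following: (a) (L-shaped domain) $\Omega=(-1,1)^2\setminus[-1,0]^2$, $\Omega_1=(-1,1)\times(0,1)$, $\Omega_2=(0,1)\times(-1,1)$; (b) (pentagonal domain) $\Omega_1=(-1,1)^2$, $\Omega_2$ the open square with vertices $(1,-1)$, $(2,0)$, $(1,1)$, $(0,0)$, and $\Omega=\Omega_1\cup\Omega_2$. Then $\Omega=\Omega_1\cup\Omega_2$, and for every $v\in H^1_0(\Omega)$ there exist $v_1\in H^1_0(\Omega_1)$ and $v_2\in H^1_0(\Omega_2)$ such that $v=v_1+v_2$ almost everywhere. Consequently, identifying $H^1_0(\Omega_i)$ with the subspace $H_i$ of $H^1_0(\Omega)$ that consists of the extensions by zero of its elements, $H_1$ and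 $H_2$ are closed subspaces of the Hilbert space $H^1_0(\Omega)$, and every $v\in H^1_0(\Omega)$ is a sum $v=w_1+w_2$ with $w_i\in H_i$. -/

import Mathlib

open MeasureTheory TopologicalSpace
open scoped Distributions InnerProductSpace

noncomputable section

/-- The Euclidean plane. -/
abbrev Plane : Type := EuclideanSpace ℝ (Fin 2)

/-- `L²(U; F)` for an open set `U` of the plane. -/
abbrev LTwo (U : Opens Plane) (F : Type) [NormedAddCommGroup F] : Type :=
  Lp F 2 ((volume : Measure Plane).restrict (U : Set Plane))

/-- `g` is the weak gradient of `u` on `U`: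
`∫_U u ∂ᵢφ = - ∫_U gᵢ φ` for every test function `φ ∈ C_c^∞(U)` and `i = 0, 1`. -/
def IsWeakGradient (U : Opens Plane) (u : LTwo U ℝ) (g : LTwo U Plane) : Prop :=
  ∀ φ : 𝓓(U, ℝ), ∀ i : Fin 2,
    ∫ x in (U : Set Plane), u x * fderiv ℝ φ x (EuclideanSpace.single i 1) =
      - ∫ x in (U : Set Plane), g x i * φ x

/-- The `L²` class of a continuous compactly supported function. -/
def compactToL2 (U : Opens Plane) {F : Type} [NormedAddCommGroup F] (ψ : Plane → F)
    (hc : Continuous ψ) (hs : HasCompactSupport ψ) : LTwo U F :=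
  ((hc.memLp_of_hasCompactSupport (p := 2) (μ := (volume : Measure Plane)) hs).restrict
    (U : Set Plane)).toLp ψ

theorem integral_mul_eq_inner (U : Opens Plane) (u : LTwo U ℝ) (ψ : Plane → ℝ)
    (hc : Continuous ψ) (hs : HasCompactSupport ψ) :
    ∫ x in (U : Set Plane), u x * ψ x = ⟪compactToL2 U ψ hc hs, u⟫_ℝ := by
  rw [L2.inner_def]
  apply integral_congr_ae
  filter_upwards [MemLp.coeFn_toLp
    ((hc.memLp_of_hasCompactSupport (p := 2) (μ := (volume : Measure Plane)) hs).restrict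
      (U : Set Plane))] with x hx
  simp [compactToL2, hx]

theorem integral_coord_mul_eq_inner (U : Opens Plane) (g : LTwo U Plane) (i : Fin 2)
    (ψ : Plane → ℝ) (hc : Continuous ψ) (hs : HasCompactSupport ψ) :
    ∫ x in (U : Set Plane), g x i * ψ x =
      ⟪compactToL2 U (fun x => ψ x • EuclideanSpace.single i (1 : ℝ))
        (hc.smul continuous_const) (hs.smul_right), g⟫_ℝ := by
  rw [L2.inner_def]
  apply integral_congr_ae
  have hm : MemLp (fun x => ψ x • EuclideanSpace.single i (1 : ℝ)) 2
      ((volume : Measure Plane).restrict (U : Set Plane)) :=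
    (Continuous.memLp_of_hasCompactSupport (hc.smul continuous_const) hs.smul_right).restrict _
  filter_upwards [hm.coeFn_toLp] with x hx
  simp only [compactToL2]
  rw [hx]
  simp [inner_smul_left, EuclideanSpace.inner_single_left]
  ring

theorem fderiv_testFunction_continuous {U : Opens Plane} (φ : 𝓓(U, ℝ)) (y : Plane) :
    Continuous fun x => fderiv ℝ φ x y :=
  (φ.contDiff.continuous_fderiv (by simp)).clm_apply continuous_const

theorem fderiv_testFunction_hasCompactSupport {U : Opens Plane} (φ : 𝓓(U, ℝ)) (y : Plane) :
    HasCompactSupport fun x => fderiv ℝ φ x y :=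
  φ.hasCompactSupport.fderiv_apply ℝ y

theorem isWeakGradient_iff (U : Opens Plane) (u : LTwo U ℝ) (g : LTwo U Plane) :
    IsWeakGradient U u g ↔ ∀ φ : 𝓓(U, ℝ), ∀ i : Fin 2,
      ⟪compactToL2 U _ (fderiv_testFunction_continuous φ (EuclideanSpace.single i 1))
        (fderiv_testFunction_hasCompactSupport φ (EuclideanSpace.single i 1)), u⟫_ℝ =
      - ⟪compactToL2 U (fun x => φ x • EuclideanSpace.single i (1 : ℝ))
        (φ.continuous.smul continuous_const) (φ.hasCompactSupport.smul_right), g⟫_ℝ := by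
  refine forall_congr' fun φ => forall_congr' fun i => ?_
  rw [← integral_mul_eq_inner, ← integral_coord_mul_eq_inner U g i φ φ.continuous
    φ.hasCompactSupport]

/-- The Sobolev space `H¹(U)`: the pairs `(u, ∇u)` with `u ∈ L²(U)` and weak gradient
`∇u ∈ L²(U; ℝ²)`, with the inner product `∫_U u v + ∫_U ∇u · ∇v` inherited from
`L²(U) × L²(U; ℝ²)`. -/
def SobolevH1 (U : Opens Plane) : Submodule ℝ (WithLp 2 (LTwo U ℝ × LTwo U Plane)) where
  carrier := {p | IsWeakGradient U p.fst p.snd}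
  zero_mem' := by
    simp [isWeakGradient_iff]
  add_mem' := by
    intro p q hp hq
    simp only [Set.mem_ofPred_eq, isWeakGradient_iff] at hp hq ⊢
    intro φ i
    rw [WithLp.add_fst, WithLp.add_snd, inner_add_right, inner_add_right, hp φ i, hq φ i]
    ring
  smul_mem' := by
    intro c p hp
    simp only [Set.mem_ofPred_eq, isWeakGradient_iff] at hp ⊢
    intro φ i
    rw [WithLp.smul_fst, WithLp.smul_snd, inner_smul_right, inner_smul_right, hp φ i]
    ring

theorem isClosed_sobolevH1 (U : Opens Plane) :
    IsClosed (SobolevH1 U : Set (WithLp 2 (LTwo U ℝ × LTwo U Plane))) := by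
  have : (SobolevH1 U : Set (WithLp 2 (LTwo U ℝ × LTwo U Plane))) =
      {p | IsWeakGradient U p.fst p.snd} := rfl
  rw [this]
  simp only [isWeakGradient_iff, Set.ofPred_forall]
  refine isClosed_iInter fun φ => isClosed_iInter fun i => isClosed_eq ?_ ?_
  · exact continuous_const.inner (WithLp.prod_continuous_ofLp 2 _ _).fst
  · exact (continuous_const.inner (WithLp.prod_continuous_ofLp 2 _ _).snd).neg

instance (U : Opens Plane) : CompleteSpace (SobolevH1 U) :=
  (isClosed_sobolevH1 U).completeSpace_coe

/-- The elements of `H¹(U)` that are represented by functions in `C_c^∞(U)`. -/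
def testFunctionsH1 (U : Opens Plane) : Submodule ℝ (SobolevH1 U) where
  carrier := {v | ∃ φ : 𝓓(U, ℝ),
    v.1.fst =ᵐ[(volume : Measure Plane).restrict (U : Set Plane)] φ}
  zero_mem' := ⟨0, Lp.coeFn_zero _ _ _⟩
  add_mem' := by
    rintro v w ⟨φ, hφ⟩ ⟨ψ, hψ⟩
    exact ⟨φ + ψ, (Lp.coeFn_add v.1.fst w.1.fst).trans (hφ.add hψ)⟩
  smul_mem' := by
    rintro c v ⟨φ, hφ⟩
    exact ⟨c • φ, (Lp.coeFn_smul c v.1.fst).trans (hφ.const_smul c)⟩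

/-- `H¹₀(U)`: the closure of `C_c^∞(U)` in `H¹(U)`. -/
def SobolevH10 (U : Opens Plane) : Submodule ℝ (SobolevH1 U) :=
  (testFunctionsH1 U).topologicalClosure

instance (U : Opens Plane) : CompleteSpace (SobolevH10 U) :=
  (Submodule.isClosed_topologicalClosure _).completeSpace_coe

/-- The extension by zero to the whole plane of (a representative of) `v ∈ H¹₀(U)`. -/
def zeroExtension {U : Opens Plane} (v : SobolevH10 U) : Plane → ℝ :=
  (U : Set Plane).indicator (v : SobolevH1 U).1.fst

theorem zeroExtension_zero (U : Opens Plane) :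
    zeroExtension (0 : SobolevH10 U) =ᵐ[volume] 0 := by
  have h := (ae_restrict_iff' U.isOpen.measurableSet).1
    (Lp.coeFn_zero ℝ 2 ((volume : Measure Plane).restrict (U : Set Plane)))
  filter_upwards [h] with x hx
  by_cases hU : x ∈ (U : Set Plane)
  · simpa [zeroExtension, Set.indicator_of_mem hU] using hx hU
  · simp [zeroExtension, Set.indicator_of_notMem hU]

theorem zeroExtension_add {U : Opens Plane} (v w : SobolevH10 U) :
    zeroExtension (v + w) =ᵐ[volume] zeroExtension v + zeroExtension w := by
  have h := (ae_restrict_iff' U.isOpen.measurableSet).1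
    (Lp.coeFn_add (v : SobolevH1 U).1.fst (w : SobolevH1 U).1.fst)
  filter_upwards [h] with x hx
  by_cases hU : x ∈ (U : Set Plane)
  · simpa [zeroExtension, Set.indicator_of_mem hU] using hx hU
  · simp [zeroExtension, Set.indicator_of_notMem hU]

theorem zeroExtension_smul {U : Opens Plane} (c : ℝ) (v : SobolevH10 U) :
    zeroExtension (c • v) =ᵐ[volume] c • zeroExtension v := by
  have h := (ae_restrict_iff' U.isOpen.measurableSet).1
    (Lp.coeFn_smul c (v : SobolevH1 U).1.fst)
  filter_upwards [h] with x hx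
  by_cases hU : x ∈ (U : Set Plane)
  · simpa [zeroExtension, Set.indicator_of_mem hU] using hx hU
  · simp [zeroExtension, Set.indicator_of_notMem hU]

/-- `H¹₀(U)` as a subspace of `H¹₀(Ω)` (for `U ⊆ Ω`): the elements of `H¹₀(Ω)` that are extensions
by zero of elements of `H¹₀(U)`. -/
def extendedH10 (Ω U : Opens Plane) : Submodule ℝ (SobolevH10 Ω) where
  carrier := {v | ∃ w : SobolevH10 U, zeroExtension v =ᵐ[volume] zeroExtension w}
  zero_mem' := ⟨0, (zeroExtension_zero Ω).trans (zeroExtension_zero U).symm⟩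
  add_mem' := by
    rintro v v' ⟨w, hw⟩ ⟨w', hw'⟩
    exact ⟨w + w', (zeroExtension_add v v').trans
      ((hw.add hw').trans (zeroExtension_add w w').symm)⟩
  smul_mem' := by
    rintro c v ⟨w, hw⟩
    exact ⟨c • w, (zeroExtension_smul c v).trans
      ((hw.const_smul c).trans (zeroExtension_smul c w).symm)⟩

/-- A finite family of subspaces of a Hilbert space `H` is *decomposing* if its members are closed
and every `v ∈ H` is a sum `∑ i, v i` with `v i` in the `i`-th subspace. -/
def IsDecomposingFamily {H : Type*} [NormedAddCommGroup H] [InnerProductSpace ℝ H]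
    [CompleteSpace H] {m : ℕ} (V : Fin m → Submodule ℝ H) : Prop :=
  (∀ i, IsClosed (V i : Set H)) ∧
    ∀ v : H, ∃ w : Fin m → H, (∀ i, w i ∈ V i) ∧ v = ∑ i, w i

/-- The open axis-parallel rectangle `(a, b) × (c, d)`. -/
def openRectangle (a b c d : ℝ) : Opens Plane where
  carrier := {x | x 0 ∈ Set.Ioo a b ∧ x 1 ∈ Set.Ioo c d}
  is_open' := (isOpen_Ioo.preimage (by fun_prop)).inter (isOpen_Ioo.preimage (by fun_prop))

/-- The L-shape `(-1, 1)² \ [-1, 0]²`. -/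
def lShape : Opens Plane where
  carrier := {x | x 0 ∈ Set.Ioo (-1) 1 ∧ x 1 ∈ Set.Ioo (-1) 1} \
    {x | x 0 ∈ Set.Icc (-1) 0 ∧ x 1 ∈ Set.Icc (-1) 0}
  is_open' := (openRectangle (-1) 1 (-1) 1).isOpen.sdiff
    ((isClosed_Icc.preimage (by fun_prop)).inter (isClosed_Icc.preimage (by fun_prop)))

/-- The horizontal rectangle `(-1, 1) × (0, 1)` of the cover of the L-shape. -/
def lShapeOne : Opens Plane := openRectangle (-1) 1 0 1

/-- The vertical rectangle `(0, 1) × (-1, 1)` of the cover of the L-shape. -/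
def lShapeTwo : Opens Plane := openRectangle 0 1 (-1) 1

/-- The square `(-1, 1)²` of the cover of the pentagonal domain. -/
def pentagonOne : Opens Plane := openRectangle (-1) 1 (-1) 1

/-- The open rotated square with vertices `(1, -1)`, `(2, 0)`, `(1, 1)`, `(0, 0)`. -/
def pentagonTwo : Opens Plane where
  carrier := {x | |x 0 - 1| + |x 1| < 1}
  is_open' := isOpen_lt (by fun_prop) continuous_const

/-- The pentagonal domain, whose vertices are `(-1, -1)`, `(1, -1)`, `(2, 0)`, `(1, 1)`,
`(-1, 1)`. -/
def pentagon : Opens Plane := pentagonOne ⊔ pentagonTwo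

end

noncomputable section

open Set Filter Topology
open scoped Gradient ContDiff Convolution ENNReal NNReal Pointwise
open ContinuousLinearMap (lsmul)

/-! The splitting comes from folding the plane along a vertical line. Let `F` be the identity on one
closed side of the line (the kept side) and the reflection on the other, and write `v = v ∘ F + (v -
v ∘ F)`. The first term is the kept part of `v` together with its mirror image. The second vanishes
on the kept side. For the L-shape the line is `x₀ = 0` and the left side is kept: there `Ω` is the
left half of `Ω₁`, which is symmetric in the line, and the rest of `Ω` lies in `Ω₂`. For the
pentagon the line is `x₀ = 1` and the right side is kept: there `Ω` is the right half of the rotated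
square `Ω₂`, and the rest lies in `Ω₁`.

It remains to see that both terms have zero boundary values in the sense of `H¹₀`. Extension by zero
identifies every `H¹₀(U)` isometrically with the closure of `testPairs U` in one space of pairs
(function, gradient) on the plane. There `foldPair` is continuous, so only test functions have to be
split. For a test function both terms are Lipschitz with compact support, and their gradients are
continuous off the fold line, a null set. Mollification then approximates them in `H¹`
(`mem_closure_testPairs_of_lipschitz`). The support of the second term may touch the fold line, so
its mollifiers are centred off the origin to push it away from the kept side.

Closedness of the subspaces follows from the same identification, because a weak gradient is
determined by its function. -/

/-! ### Extension by zero to the whole plane. -/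

theorem memLp_indicator_lTwo {U : Opens Plane} {F : Type} [NormedAddCommGroup F] (u : LTwo U F) :
    MemLp ((U : Set Plane).indicator u) 2 (volume : Measure Plane) :=
  (memLp_indicator_iff_restrict U.isOpen.measurableSet).2 (Lp.memLp u)

/-- Extension by zero, as a linear isometry from `L²(U; F)` into `L²` of the plane. -/
def extendLTwo (U : Opens Plane) (F : Type) [NormedAddCommGroup F] [NormedSpace ℝ F] :
    LTwo U F →ₗᵢ[ℝ] Lp F 2 (volume : Measure Plane) where
  toFun u := (memLp_indicator_lTwo u).toLp _
  map_add' u v := by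
    rw [← MemLp.toLp_add]
    refine MemLp.toLp_congr _ _ ?_
    have h := (ae_restrict_iff' U.isOpen.measurableSet).1 (Lp.coeFn_add u v)
    filter_upwards [h] with x hx
    by_cases hU : x ∈ (U : Set Plane)
    · simpa [indicator_of_mem hU] using hx hU
    · simp [indicator_of_notMem hU]
  map_smul' c u := by
    rw [RingHom.id_apply, ← MemLp.toLp_const_smul]
    refine MemLp.toLp_congr _ _ ?_
    have h := (ae_restrict_iff' U.isOpen.measurableSet).1 (Lp.coeFn_smul c u)
    filter_upwards [h] with x hx
    by_cases hU : x ∈ (U : Set Plane)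
    · simpa [indicator_of_mem hU] using hx hU
    · simp [indicator_of_notMem hU]
  norm_map' u := by
    change ‖MemLp.toLp _ (memLp_indicator_lTwo u)‖ = _
    rw [Lp.norm_toLp, eLpNorm_indicator_eq_eLpNorm_restrict U.isOpen.measurableSet, Lp.norm_def]

theorem coeFn_extendLTwo {U : Opens Plane} {F : Type} [NormedAddCommGroup F] [NormedSpace ℝ F]
    (u : LTwo U F) : extendLTwo U F u =ᵐ[volume] (U : Set Plane).indicator u :=
  MemLp.coeFn_toLp (memLp_indicator_lTwo u)

/-- The space of pairs `(u, g)` with `u ∈ L²(ℝ²)` and `g ∈ L²(ℝ²; ℝ²)`. -/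
abbrev LTwoPair : Type :=
  WithLp 2 (Lp ℝ 2 (volume : Measure Plane) × Lp Plane 2 (volume : Measure Plane))

/-- Extension by zero of a Sobolev function and of its weak gradient. -/
def extendH1 (U : Opens Plane) : SobolevH1 U →ₗᵢ[ℝ] LTwoPair where
  toFun v := WithLp.toLp 2 (extendLTwo U ℝ v.1.fst, extendLTwo U Plane v.1.snd)
  map_add' v w := by
    rw [← WithLp.toLp_add, Prod.mk_add_mk, ← map_add, ← map_add]
    rfl
  map_smul' c v := by
    rw [RingHom.id_apply, ← WithLp.toLp_smul, Prod.smul_mk, ← map_smul, ← map_smul]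
    rfl
  norm_map' v := by
    change ‖WithLp.toLp 2 (extendLTwo U ℝ v.1.fst, extendLTwo U Plane v.1.snd)‖ = ‖v.1‖
    rw [WithLp.prod_norm_eq_of_L2, WithLp.prod_norm_eq_of_L2]
    simp

/-! ### Classical and weak gradients; `H¹₀` as a closure of test pairs. -/

theorem gradient_apply (φ : Plane → ℝ) (x : Plane) (i : Fin 2) :
    ∇ φ x i = fderiv ℝ φ x (EuclideanSpace.single i 1) := by
  rw [← toDual_gradient, InnerProductSpace.toDual_apply_apply, EuclideanSpace.inner_single_right]
  simp

theorem norm_gradient (φ : Plane → ℝ) (x : Plane) : ‖∇ φ x‖ = ‖fderiv ℝ φ x‖ := by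
  rw [← toDual_gradient, LinearIsometryEquiv.norm_map]

theorem continuousAt_gradient_iff {φ : Plane → ℝ} {x : Plane} :
    ContinuousAt (∇ φ) x ↔ ContinuousAt (fderiv ℝ φ) x := by
  rw [← toDual_comp_gradient]
  exact ((InnerProductSpace.toDual ℝ Plane).toHomeomorph.comp_continuousAt_iff _ _).symm

theorem support_gradient_subset (φ : Plane → ℝ) : Function.support (∇ φ) ⊆ tsupport φ := by
  intro x hx
  refine support_fderiv_subset ℝ (f := φ) ?_
  rw [Function.mem_support, ← norm_ne_zero_iff, ← norm_gradient]
  exact norm_ne_zero_iff.2 hx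

theorem hasCompactSupport_gradient {φ : Plane → ℝ} (h : HasCompactSupport φ) :
    HasCompactSupport (∇ φ) :=
  h.mono' (support_gradient_subset φ)

theorem continuous_gradient {φ : Plane → ℝ} (h : ContDiff ℝ ∞ φ) : Continuous (∇ φ) :=
  continuous_iff_continuousAt.2 fun _ =>
    continuousAt_gradient_iff.2 (h.continuous_fderiv (by simp)).continuousAt

/-- The pairs `(φ, ∇φ)` with `φ ∈ C_c^∞(U)`, as elements of `L²(ℝ²) × L²(ℝ²; ℝ²)`. -/
def testPairs (U : Opens Plane) : Set LTwoPair :=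
  {p | ∃ φ : Plane → ℝ, ContDiff ℝ ∞ φ ∧ HasCompactSupport φ ∧ tsupport φ ⊆ U ∧
    p.fst =ᵐ[volume] φ ∧ p.snd =ᵐ[volume] ∇ φ}

theorem testPairs_mono {U V : Opens Plane} (h : U ≤ V) : testPairs U ⊆ testPairs V :=
  fun _ ⟨φ, h₁, h₂, h₃, h₄⟩ => ⟨φ, h₁, h₂, h₃.trans h, h₄⟩

/-- Integration by parts over the whole plane. The support of `φ` need not lie in `U`, since that of
the test function `ψ` does. -/
theorem isWeakGradient_of_contDiff {U : Opens Plane} {φ : Plane → ℝ} (hφ : ContDiff ℝ ∞ φ)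
    (hc : HasCompactSupport φ) {u : LTwo U ℝ} {g : LTwo U Plane}
    (hu : u =ᵐ[volume.restrict (U : Set Plane)] φ)
    (hg : g =ᵐ[volume.restrict (U : Set Plane)] ∇ φ) : IsWeakGradient U u g := by
  intro ψ i
  have h1 : ∫ x in (U : Set Plane), u x * fderiv ℝ ψ x (EuclideanSpace.single i 1) =
      ∫ x, φ x * fderiv ℝ ψ x (EuclideanSpace.single i 1) := by
    rw [← setIntegral_eq_integral_of_forall_compl_eq_zero (s := (U : Set Plane))
      (f := fun x => φ x * fderiv ℝ ψ x (EuclideanSpace.single i 1))]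
    · exact integral_congr_ae (hu.mono fun x hx => by simp only [hx])
    · intro x hx
      rw [image_eq_zero_of_notMem_tsupport (f := fderiv ℝ ψ)]
      · simp
      · exact fun h => hx (ψ.tsupport_subset (tsupport_fderiv_subset ℝ h))
  have h2 : ∫ x in (U : Set Plane), g x i * ψ x =
      ∫ x, fderiv ℝ φ x (EuclideanSpace.single i 1) * ψ x := by
    rw [← setIntegral_eq_integral_of_forall_compl_eq_zero (s := (U : Set Plane))
      (f := fun x => fderiv ℝ φ x (EuclideanSpace.single i 1) * ψ x)]
    · exact integral_congr_ae (hg.mono fun x hx => by simp only [hx, gradient_apply])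
    · intro x hx
      rw [image_eq_zero_of_notMem_tsupport (f := ψ)]
      · simp
      · exact fun h => hx (ψ.tsupport_subset h)
  rw [h1, h2]
  have hφ' : Continuous fun x => fderiv ℝ φ x (EuclideanSpace.single i 1) :=
    (hφ.continuous_fderiv (by simp)).clm_apply continuous_const
  refine integral_mul_fderiv_eq_neg_fderiv_mul_of_integrable ?_ ?_ ?_ ?_ ?_
  · exact (hφ'.mul ψ.continuous).integrable_of_hasCompactSupport (ψ.hasCompactSupport.mul_left)
  · exact (hφ.continuous.mul (fderiv_testFunction_continuous ψ _)).integrable_of_hasCompactSupport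
      hc.mul_right
  · exact (hφ.continuous.mul ψ.continuous).integrable_of_hasCompactSupport hc.mul_right
  · exact fun x _ => hφ.differentiable (by simp) x
  · exact fun x _ => ψ.contDiff.differentiable (by simp) x

/-- The fundamental lemma of the calculus of variations, applied to each coordinate of `g - g'`. -/
theorem IsWeakGradient.unique {U : Opens Plane} {u : LTwo U ℝ} {g g' : LTwo U Plane}
    (h : IsWeakGradient U u g) (h' : IsWeakGradient U u g') : g = g' := by
  rw [← sub_eq_zero]
  have key (i : Fin 2) : ∀ᵐ x ∂(volume : Measure Plane), x ∈ (U : Set Plane) →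
      (g - g') x i = 0 := by
    refine U.isOpen.ae_eq_zero_of_integral_contDiff_smul_eq_zero ?_ ?_
    · have hm : MemLp (fun x => (g - g') x i) 2 (volume.restrict (U : Set Plane)) :=
        (EuclideanSpace.proj (𝕜 := ℝ) i).comp_memLp (g - g')
      exact locallyIntegrableOn_of_locallyIntegrable_restrict
        (hm.locallyIntegrable (by norm_num))
    · intro ψ hψ hc hs
      let ψ' : 𝓓(U, ℝ) := ⟨ψ, hψ, hc, hs⟩
      have e := neg_injective ((h ψ' i).symm.trans (h' ψ' i))
      have e' : ∫ x in (U : Set Plane), (g - g') x i * ψ x = 0 := by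
        rw [integral_coord_mul_eq_inner U (g - g') i ψ hψ.continuous hc, inner_sub_right,
          ← integral_coord_mul_eq_inner U g i ψ hψ.continuous hc,
          ← integral_coord_mul_eq_inner U g' i ψ hψ.continuous hc, sub_eq_zero]
        exact e
      rw [← e', ← setIntegral_eq_integral_of_forall_compl_eq_zero (s := (U : Set Plane))]
      · exact integral_congr_ae (.of_forall fun x => by simp [mul_comm])
      · intro x hx
        rw [image_eq_zero_of_notMem_tsupport fun hx' => hx (hs hx'), zero_smul]
  refine Lp.eq_zero_iff_ae_eq_zero.2 ?_
  refine (ae_restrict_iff' U.isOpen.measurableSet).2 ?_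
  filter_upwards [key 0, key 1] with x h0 h1 hx
  ext i
  fin_cases i
  · exact h0 hx
  · exact h1 hx

theorem sobolevH1_ext {U : Opens Plane} {v w : SobolevH1 U} (h : v.1.fst = w.1.fst) : v = w := by
  have h2 : v.1.snd = w.1.snd := by
    have hv : IsWeakGradient U v.1.fst v.1.snd := v.2
    rw [h] at hv
    exact hv.unique w.2
  exact Subtype.ext (WithLp.ofLp_injective 2 (Prod.ext h h2))

theorem image_testFunctionsH1 (U : Opens Plane) :
    extendH1 U '' (testFunctionsH1 U : Set (SobolevH1 U)) = testPairs U := by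
  have hind {F : Type} [NormedAddCommGroup F] [NormedSpace ℝ F] {u : LTwo U F} {f : Plane → F}
      (hu : u =ᵐ[volume.restrict (U : Set Plane)] f) (hf : Function.support f ⊆ U) :
      extendLTwo U F u =ᵐ[volume] f := by
    filter_upwards [coeFn_extendLTwo u, (ae_restrict_iff' U.isOpen.measurableSet).1 hu]
      with x hx hx'
    by_cases hxU : x ∈ (U : Set Plane)
    · rw [hx, indicator_of_mem hxU, hx' hxU]
    · rw [hx, indicator_of_notMem hxU, Function.notMem_support.1 fun h => hxU (hf h)]
  have hex (φ : Plane → ℝ) (hφ : ContDiff ℝ ∞ φ) (hc : HasCompactSupport φ) :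
      ∃ w : SobolevH1 U, w.1.fst =ᵐ[volume.restrict (U : Set Plane)] φ ∧
        w.1.snd =ᵐ[volume.restrict (U : Set Plane)] ∇ φ := by
    have h1 : compactToL2 U φ hφ.continuous hc =ᵐ[volume.restrict (U : Set Plane)] φ :=
      MemLp.coeFn_toLp _
    have h2 : compactToL2 U (∇ φ) (continuous_gradient hφ) (hasCompactSupport_gradient hc)
        =ᵐ[volume.restrict (U : Set Plane)] ∇ φ := MemLp.coeFn_toLp _
    exact ⟨⟨WithLp.toLp 2 (_, _), isWeakGradient_of_contDiff hφ hc h1 h2⟩, h1, h2⟩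
  ext p
  constructor
  · rintro ⟨v, ⟨φ, hv⟩, rfl⟩
    obtain ⟨w, hw, hw'⟩ := hex φ φ.contDiff φ.hasCompactSupport
    -- Only the function part of `v` is known to be a test function; uniqueness forces its gradient
    -- part to be `∇ φ`.
    obtain rfl : v = w := sobolevH1_ext (Lp.ext (hv.trans hw.symm))
    exact ⟨φ, φ.contDiff, φ.hasCompactSupport, φ.tsupport_subset,
      hind hv ((subset_tsupport _).trans φ.tsupport_subset),
      hind hw' ((support_gradient_subset _).trans φ.tsupport_subset)⟩
  · rintro ⟨φ, hφ, hc, hs, hp, hp'⟩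
    obtain ⟨w, hw, hw'⟩ := hex φ hφ hc
    refine ⟨w, ⟨⟨φ, hφ, hc, hs⟩, hw⟩, WithLp.ofLp_injective 2 (Prod.ext ?_ ?_)⟩
    · exact Lp.ext ((hind hw ((subset_tsupport _).trans hs)).trans hp.symm)
    · exact Lp.ext ((hind hw' ((support_gradient_subset _).trans hs)).trans hp'.symm)

/-- An isometry of a complete space is a closed embedding, so it commutes with closures. All the
spaces `H¹₀(U)` can now be compared inside `LTwoPair`. -/
theorem image_sobolevH10 (U : Opens Plane) :
    extendH1 U '' (SobolevH10 U : Set (SobolevH1 U)) = closure (testPairs U) := by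
  rw [← image_testFunctionsH1, (extendH1 U).isometry.isClosedEmbedding.closure_image_eq]
  rfl

theorem extendH1_mem_closure {U : Opens Plane} (v : SobolevH10 U) :
    extendH1 U v ∈ closure (testPairs U) := by
  rw [← image_sobolevH10]
  exact mem_image_of_mem _ v.2

theorem exists_extendH1_eq {U : Opens Plane} {p : LTwoPair} (hp : p ∈ closure (testPairs U)) :
    ∃ v : SobolevH10 U, extendH1 U v = p := by
  rw [← image_sobolevH10] at hp
  obtain ⟨v, hv, rfl⟩ := hp
  exact ⟨⟨v, hv⟩, rfl⟩

theorem eq_of_fst_eq {U : Opens Plane} {p q : LTwoPair} (hp : p ∈ closure (testPairs U))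
    (hq : q ∈ closure (testPairs U)) (h : p.fst = q.fst) : p = q := by
  obtain ⟨v, rfl⟩ := exists_extendH1_eq hp
  obtain ⟨w, rfl⟩ := exists_extendH1_eq hq
  exact congrArg _ (sobolevH1_ext ((extendLTwo U ℝ).injective h))

theorem fst_extendH1_ae {U : Opens Plane} (v : SobolevH10 U) :
    (extendH1 U v).fst =ᵐ[volume] zeroExtension v :=
  coeFn_extendLTwo (v : SobolevH1 U).1.fst

/-! ### The subspaces of extensions by zero. -/

/-- Equality of zero extensions concerns functions only; `eq_of_fst_eq`, applied in `Ω`, upgrades it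
to equality of pairs. This form makes the subspace the preimage of a closed set. -/
theorem mem_extendedH10_iff {Ω U : Opens Plane} (hU : U ≤ Ω) (v : SobolevH10 Ω) :
    v ∈ extendedH10 Ω U ↔ extendH1 Ω v ∈ closure (testPairs U) := by
  constructor
  · rintro ⟨w, hw⟩
    have hw' := extendH1_mem_closure w
    rwa [eq_of_fst_eq (extendH1_mem_closure v) (closure_mono (testPairs_mono hU) hw')]
    exact Lp.ext ((fst_extendH1_ae v).trans (hw.trans (fst_extendH1_ae w).symm))
  · intro h
    obtain ⟨w, hw⟩ := exists_extendH1_eq h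
    refine ⟨w, (fst_extendH1_ae v).symm.trans ?_⟩
    rw [← hw]
    exact fst_extendH1_ae w

theorem isClosed_extendedH10 {Ω U : Opens Plane} (hU : U ≤ Ω) :
    IsClosed (extendedH10 Ω U : Set (SobolevH10 Ω)) := by
  have : (extendedH10 Ω U : Set (SobolevH10 Ω)) =
      (fun v : SobolevH10 Ω => extendH1 Ω v) ⁻¹' closure (testPairs U) :=
    Set.ext fun v => mem_extendedH10_iff hU v
  rw [this]
  exact isClosed_closure.preimage ((extendH1 Ω).continuous.comp continuous_subtype_val)

/-- If every element of `H¹₀(Ω)` splits at the level of pairs (function, gradient), then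
`H¹₀(U₁)` and `H¹₀(U₂)` form a decomposing family of `H¹₀(Ω)`. -/
theorem decomposition_of_split {Ω U₁ U₂ : Opens Plane} (h₁ : U₁ ≤ Ω) (h₂ : U₂ ≤ Ω)
    (h : ∀ p ∈ closure (testPairs Ω), ∃ q ∈ closure (testPairs U₁),
      ∃ r ∈ closure (testPairs U₂), p = q + r) :
    (∀ v : SobolevH10 Ω, ∃ v₁ : SobolevH10 U₁, ∃ v₂ : SobolevH10 U₂,
      zeroExtension v =ᵐ[volume] zeroExtension v₁ + zeroExtension v₂) ∧
    IsDecomposingFamily (H := SobolevH10 Ω) (fun i : Fin 2 => extendedH10 Ω (![U₁, U₂] i)) := by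
  refine ⟨fun v => ?_, fun i => ?_, fun v => ?_⟩
  · obtain ⟨q, hq, r, hr, e⟩ := h _ (extendH1_mem_closure v)
    obtain ⟨v₁, rfl⟩ := exists_extendH1_eq hq
    obtain ⟨v₂, rfl⟩ := exists_extendH1_eq hr
    refine ⟨v₁, v₂, (fst_extendH1_ae v).symm.trans ?_⟩
    rw [e, WithLp.add_fst]
    exact (Lp.coeFn_add _ _).trans ((fst_extendH1_ae v₁).add (fst_extendH1_ae v₂))
  · fin_cases i
    · exact isClosed_extendedH10 h₁
    · exact isClosed_extendedH10 h₂
  · obtain ⟨q, hq, r, hr, e⟩ := h _ (extendH1_mem_closure v)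
    obtain ⟨w₁, rfl⟩ := exists_extendH1_eq (closure_mono (testPairs_mono h₁) hq)
    obtain ⟨w₂, rfl⟩ := exists_extendH1_eq (closure_mono (testPairs_mono h₂) hr)
    refine ⟨![w₁, w₂], fun i => ?_, ?_⟩
    · fin_cases i
      · exact (mem_extendedH10_iff h₁ w₁).2 hq
      · exact (mem_extendedH10_iff h₂ w₂).2 hr
    · rw [← map_add] at e
      simpa using Subtype.ext ((extendH1 Ω).injective e)

/-! ### Mollification with shifted kernels. -/

theorem tendsto_eLpNorm_two_of_dominated {α F : Type*} [MeasurableSpace α] {μ : Measure α}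
    [NormedAddCommGroup F] {f : ℕ → α → F} {g : α → F} {b : α → ℝ} (hb : MemLp b 2 μ)
    (hf : ∀ n, AEStronglyMeasurable (f n) μ) (hg : AEStronglyMeasurable g μ)
    (hfb : ∀ n x, ‖f n x - g x‖ ≤ b x)
    (hlim : ∀ᵐ x ∂μ, Tendsto (fun n => f n x) atTop (𝓝 (g x))) :
    Tendsto (fun n => eLpNorm (f n - g) 2 μ) atTop (𝓝 0) := by
  have key : Tendsto (fun n => ∫⁻ x, ‖(f n - g) x‖ₑ ^ (2 : ℝ) ∂μ) atTop
      (𝓝 (∫⁻ _, 0 ∂μ)) := by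
    refine tendsto_lintegral_of_dominated_convergence' (fun x => ‖b x‖ₑ ^ (2 : ℝ)) (fun n => ?_)
      (fun n => ?_) ?_ ?_
    · exact ((hf n).sub hg).enorm.pow_const _
    · refine .of_forall fun x => ENNReal.rpow_le_rpow ?_ (by norm_num)
      exact enorm_le_iff_norm_le.2 ((hfb n x).trans (le_abs_self _))
    · have h := hb.eLpNorm_lt_top
      rw [eLpNorm_lt_top_iff_lintegral_rpow_enorm_lt_top (by norm_num) (by norm_num)] at h
      simpa using h.ne
    · filter_upwards [hlim] with x hx
      have h0 : Tendsto (fun n => ‖(f n - g) x‖ₑ) atTop (𝓝 0) := by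
        simpa using (hx.sub_const (g x)).enorm
      simpa using h0.ennrpow_const 2
  have h2 := key.ennrpow_const (1 / 2 : ℝ)
  simp only [lintegral_zero] at h2
  rw [ENNReal.zero_rpow_of_pos (by norm_num)] at h2
  refine h2.congr fun n => ?_
  rw [eLpNorm_eq_lintegral_rpow_enorm_toReal (by norm_num) (by norm_num)]
  simp

/-- A smooth probability density supported in the ball of radius `1 / (n + 1)` around
`(1 / (n + 1)) • e`. -/
def mollifier (e : Plane) (n : ℕ) : Plane → ℝ :=
  ContDiffBump.normed (c := (1 / (n + 1) : ℝ) • e)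
    ⟨1 / (n + 1) / 2, 1 / (n + 1), by positivity, half_lt_self (by positivity)⟩ volume

theorem contDiff_mollifier (e : Plane) (n : ℕ) : ContDiff ℝ ∞ (mollifier e n) :=
  ContDiffBump.contDiff_normed _

theorem hasCompactSupport_mollifier (e : Plane) (n : ℕ) : HasCompactSupport (mollifier e n) :=
  ContDiffBump.hasCompactSupport_normed _

theorem tsupport_mollifier (e : Plane) (n : ℕ) :
    tsupport (mollifier e n) = Metric.closedBall ((1 / (n + 1) : ℝ) • e) (1 / (n + 1)) :=
  ContDiffBump.tsupport_normed_eq _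

theorem mollifier_nonneg (e : Plane) (n : ℕ) (x : Plane) : 0 ≤ mollifier e n x :=
  ContDiffBump.nonneg_normed _ _

theorem integral_mollifier (e : Plane) (n : ℕ) : ∫ x, mollifier e n x = 1 :=
  ContDiffBump.integral_normed _

theorem integrable_mollifier (e : Plane) (n : ℕ) : Integrable (mollifier e n) :=
  ContDiffBump.integrable_normed _

theorem norm_le_of_mem_tsupport_mollifier {e : Plane} {n : ℕ} {x : Plane}
    (hx : x ∈ tsupport (mollifier e n)) : ‖x‖ ≤ 1 / (n + 1) * (‖e‖ + 1) := by
  rw [tsupport_mollifier, mem_closedBall_iff_norm'] at hx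
  have hn : (0 : ℝ) < 1 / (n + 1) := by positivity
  have := norm_le_norm_add_norm_sub ((1 / (n + 1) : ℝ) • e) x
  rw [norm_smul, Real.norm_of_nonneg hn.le] at this
  linarith

theorem tendsto_support_mollifier (e : Plane) :
    Tendsto (fun n => Function.support (mollifier e n)) atTop (𝓝 0).smallSets := by
  rw [Metric.nhds_basis_ball.smallSets.tendsto_right_iff]
  intro ε hε
  have h : Tendsto (fun n : ℕ => 1 / ((n : ℝ) + 1) * (‖e‖ + 1)) atTop (𝓝 0) := by
    simpa using tendsto_one_div_add_atTop_nhds_zero_nat.mul_const (‖e‖ + 1)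
  filter_upwards [h.eventually_lt_const hε] with n hn x hx
  exact mem_ball_zero_iff.2
    ((norm_le_of_mem_tsupport_mollifier (subset_tsupport _ hx)).trans_lt hn)

section

variable {F : Type} [NormedAddCommGroup F] [NormedSpace ℝ F]

theorem norm_mollifier_convolution_le {f : Plane → F} {M : ℝ} (hM : ∀ x, ‖f x‖ ≤ M)
    (e : Plane) (n : ℕ) (x : Plane) :
    ‖(mollifier e n ⋆[lsmul ℝ ℝ, volume] f : Plane → F) x‖ ≤ M := by
  rw [convolution_lsmul]
  calc ‖∫ t, mollifier e n t • f (x - t)‖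
      ≤ ∫ t, mollifier e n t * M := by
        refine norm_integral_le_of_norm_le ((integrable_mollifier e n).mul_const M)
          (.of_forall fun t => ?_)
        rw [norm_smul, Real.norm_of_nonneg (mollifier_nonneg e n t)]
        exact mul_le_mul_of_nonneg_left (hM _) (mollifier_nonneg e n t)
    _ = M := by rw [integral_mul_const, integral_mollifier, one_mul]

/-- Convolutions converge at every continuity point of `f`, hence almost everywhere. The error is at
most `2M` and lives on a fixed compact set, so dominated convergence applies. -/
theorem tendsto_eLpNorm_mollifier_convolution [CompleteSpace F] {f : Plane → F} {M : ℝ}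
    (hM : ∀ x, ‖f x‖ ≤ M) (hc : HasCompactSupport f) (hm : AEStronglyMeasurable f volume)
    (hcont : ∀ᵐ x, ContinuousAt f x) (e : Plane) :
    Tendsto (fun n => eLpNorm ((mollifier e n ⋆[lsmul ℝ ℝ, volume] f : Plane → F) - f) 2 volume)
      atTop (𝓝 0) := by
  -- As `1 / (n + 1) ≤ 1`, every mollifier is supported in the ball of radius `‖e‖ + 1`, so `S`
  -- contains the supports of all the convolutions.
  set S : Set Plane := Metric.closedBall 0 (‖e‖ + 1) + tsupport f with hS
  have hSc : IsCompact S := (isCompact_closedBall _ _).add hc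
  have hloc : LocallyIntegrable f volume :=
    (memLp_top_of_bound hm M (.of_forall hM)).locallyIntegrable le_top
  have hb : MemLp (S.indicator fun _ => M + M) 2 (volume : Measure Plane) :=
    memLp_indicator_const _ hSc.measurableSet _ (.inr hSc.measure_lt_top.ne)
  refine tendsto_eLpNorm_two_of_dominated hb (fun n => ?_) hm (fun n x => ?_) ?_
  · exact ((hasCompactSupport_mollifier e n).contDiff_convolution_left (lsmul ℝ ℝ)
      (contDiff_mollifier e n) hloc).continuous.aestronglyMeasurable
  · by_cases hx : x ∈ S
    · rw [indicator_of_mem hx]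
      exact (norm_sub_le _ _).trans (add_le_add (norm_mollifier_convolution_le hM e n x) (hM x))
    · rw [indicator_of_notMem hx]
      have h1 : f x = 0 := by
        refine image_eq_zero_of_notMem_tsupport fun h => hx ?_
        exact ⟨0, by simp; positivity, x, h, zero_add x⟩
      have h2 : (mollifier e n ⋆[lsmul ℝ ℝ, volume] f : Plane → F) x = 0 := by
        by_contra h
        obtain ⟨y, hy, z, hz, rfl⟩ := support_convolution_subset (lsmul ℝ ℝ) h
        refine hx ⟨y, ?_, z, subset_tsupport _ hz, rfl⟩
        refine mem_closedBall_zero_iff.2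
          ((norm_le_of_mem_tsupport_mollifier (subset_tsupport _ hy)).trans ?_)
        refine mul_le_of_le_one_left (by positivity) ?_
        rw [div_le_one (by positivity)]
        linarith [(Nat.cast_nonneg n : (0 : ℝ) ≤ n)]
      simp [h1, h2]
  · filter_upwards [hcont] with x hx
    refine convolution_tendsto_right (.of_forall fun n => mollifier_nonneg e n)
      (.of_forall fun n => integral_mollifier e n) (tendsto_support_mollifier e)
      (.of_forall fun _ => hm) ?_ tendsto_const_nhds
    exact hx.tendsto.comp tendsto_snd

end

/-- The derivative first falls on the smooth kernel and is then moved to `w` by integration by parts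
for Lipschitz functions. Rademacher's theorem identifies the line derivatives of `w` with the
coordinates of `∇ w` almost everywhere. -/
theorem gradient_mollifier_convolution {w : Plane → ℝ} {C : ℝ≥0} (hw : LipschitzWith C w)
    (hm : LocallyIntegrable (∇ w) volume) (e : Plane) (n : ℕ) :
    ∇ (mollifier e n ⋆[lsmul ℝ ℝ, volume] w) = mollifier e n ⋆[lsmul ℝ ℝ, volume] ∇ w := by
  ext x i
  set ρ := mollifier e n with hρ
  set v : Plane := EuclideanSpace.single i 1 with hv
  have hρs : ContDiff ℝ ∞ ρ := contDiff_mollifier e n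
  have hρc : HasCompactSupport ρ := hasCompactSupport_mollifier e n
  have hwl : LocallyIntegrable w volume := hw.continuous.locallyIntegrable
  have h1 : ∇ (ρ ⋆[lsmul ℝ ℝ, volume] w) x i = ∫ y, fderiv ℝ ρ (x - y) v * w y := by
    have hd := hρc.hasFDerivAt_convolution_left (lsmul ℝ ℝ) (hρs.of_le (by simp)) hwl x
    rw [gradient_apply, hd.fderiv, convolution_def, ContinuousLinearMap.integral_apply,
      ← integral_sub_left_eq_self _ volume x]
    · simp [hv, ContinuousLinearMap.precompL_apply]
    · exact (hρc.fderiv ℝ).convolutionExists_left _ (hρs.continuous_fderiv (by simp)) hwl x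
  have h2 : (ρ ⋆[lsmul ℝ ℝ, volume] ∇ w : Plane → Plane) x i =
      ∫ y, lineDeriv ℝ w y v * ρ (x - y) := by
    have hi : Integrable (fun t => ρ t • ∇ w (x - t)) volume :=
      hρc.convolutionExists_left (lsmul ℝ ℝ) hρs.continuous hm x
    rw [convolution_lsmul]
    change EuclideanSpace.proj (𝕜 := ℝ) i (∫ t, ρ t • ∇ w (x - t)) = _
    rw [← ContinuousLinearMap.integral_comp_comm _ hi, ← integral_sub_left_eq_self _ volume x]
    refine integral_congr_ae ?_
    filter_upwards [hw.ae_differentiableAt] with y hy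
    simp [gradient_apply, hy.lineDeriv_eq_fderiv, hv, mul_comm]
  obtain ⟨D, hD⟩ := ContDiff.lipschitzWith_of_hasCompactSupport hρc hρs (by simp)
  have hD' : LipschitzWith D fun y => ρ (x - y) :=
    LipschitzWith.of_dist_le_mul fun y z =>
      (hD.dist_le_mul (x - y) (x - z)).trans_eq (by rw [dist_sub_left])
  have hc' : HasCompactSupport fun y => ρ (x - y) :=
    hρc.comp_homeomorph (Homeomorph.subLeft x)
  rw [h1, h2, hw.integral_lineDeriv_mul_eq hD' hc' v]
  refine integral_congr_ae (.of_forall fun y => ?_)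
  have hfd : HasFDerivAt (fun y => ρ (x - y)) (-fderiv ℝ ρ (x - y)) y := by
    have := (hρs.differentiable (by simp) (x - y)).hasFDerivAt.comp y
      ((hasFDerivAt_id y).const_sub x)
    simpa [Function.comp_def] using this
  simp [(hfd.hasLineDerivAt (-v)).lineDeriv]

/-- A compactly supported Lipschitz function whose support can be pushed into `U` by small
translations, and whose gradient is continuous almost everywhere, belongs to `H¹₀(U)`. -/
theorem mem_closure_testPairs_of_lipschitz {U : Opens Plane} {w : Plane → ℝ} {C : ℝ≥0}
    (hw : LipschitzWith C w) (hc : HasCompactSupport w) (hcont : ∀ᵐ x, ContinuousAt (∇ w) x)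
    (e : Plane) (hU : ∀ᶠ δ in 𝓝[>] (0 : ℝ), ∀ y ∈ Metric.closedBall (δ • e) δ,
      ∀ x ∈ tsupport w, y + x ∈ U)
    {p : LTwoPair} (hp : p.fst =ᵐ[volume] w) (hp' : p.snd =ᵐ[volume] ∇ w) :
    p ∈ closure (testPairs U) := by
  obtain ⟨M, hM⟩ := hw.continuous.bounded_above_of_compact_support hc
  have hgm : AEStronglyMeasurable (∇ w) volume := by
    have h := (InnerProductSpace.toDual ℝ Plane).symm.continuous.measurable.comp
      (measurable_fderiv ℝ w)
    exact h.aestronglyMeasurable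
  have hgM (x : Plane) : ‖∇ w x‖ ≤ C := by
    rw [norm_gradient]
    exact norm_fderiv_le_of_lipschitz ℝ hw
  have hgl : LocallyIntegrable (∇ w) volume :=
    (memLp_top_of_bound hgm C (.of_forall hgM)).locallyIntegrable le_top
  let W (n : ℕ) : Plane → ℝ := mollifier e n ⋆[lsmul ℝ ℝ, volume] w
  have hWs (n : ℕ) : ContDiff ℝ ∞ (W n) :=
    (hasCompactSupport_mollifier e n).contDiff_convolution_left (lsmul ℝ ℝ)
      (contDiff_mollifier e n) hw.continuous.locallyIntegrable
  have hWc (n : ℕ) : HasCompactSupport (W n) :=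
    (hasCompactSupport_mollifier e n).convolution (lsmul ℝ ℝ) hc
  have hW1 (n : ℕ) : MemLp (W n) 2 volume :=
    (hWs n).continuous.memLp_of_hasCompactSupport (hWc n)
  have hW2 (n : ℕ) : MemLp (∇ (W n)) 2 volume :=
    (continuous_gradient (hWs n)).memLp_of_hasCompactSupport (hasCompactSupport_gradient (hWc n))
  have hlim : Tendsto (fun n => (WithLp.toLp 2 ((hW1 n).toLp _, (hW2 n).toLp _) : LTwoPair))
      atTop (𝓝 p) := by
    have hw2 : MemLp w 2 volume := (memLp_congr_ae hp).1 (Lp.memLp _)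
    have hg2 : MemLp (∇ w) 2 volume := (memLp_congr_ae hp').1 (Lp.memLp _)
    have e1 : p.fst = hw2.toLp w := Lp.ext (hp.trans hw2.coeFn_toLp.symm)
    have e2 : p.snd = hg2.toLp (∇ w) := Lp.ext (hp'.trans hg2.coeFn_toLp.symm)
    have t1 : Tendsto (fun n => (hW1 n).toLp (W n)) atTop (𝓝 p.fst) := by
      rw [e1, Lp.tendsto_Lp_iff_tendsto_eLpNorm'']
      exact tendsto_eLpNorm_mollifier_convolution hM hc hw.continuous.aestronglyMeasurable
        (.of_forall fun x => hw.continuous.continuousAt) e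
    have t2 : Tendsto (fun n => (hW2 n).toLp (∇ (W n))) atTop (𝓝 p.snd) := by
      rw [e2, Lp.tendsto_Lp_iff_tendsto_eLpNorm'']
      simp only [W, gradient_mollifier_convolution hw hgl]
      exact tendsto_eLpNorm_mollifier_convolution hgM (hasCompactSupport_gradient hc) hgm hcont e
    exact ((WithLp.prod_continuous_toLp 2 _ _).tendsto (p.fst, p.snd)).comp (t1.prodMk_nhds t2)
  refine mem_closure_of_tendsto hlim ?_
  -- The support condition `hU` is used with `δ = 1 / (n + 1)`, for which the closed ball in it is
  -- the support of the `n`-th mollifier.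
  have hδ : Tendsto (fun n : ℕ => 1 / ((n : ℝ) + 1)) atTop (𝓝[>] 0) :=
    tendsto_nhdsWithin_iff.2 ⟨tendsto_one_div_add_atTop_nhds_zero_nat,
      .of_forall fun n => by simp; positivity⟩
  filter_upwards [hδ.eventually hU] with n hn
  refine ⟨W n, hWs n, hWc n, ?_, (hW1 n).coeFn_toLp, (hW2 n).coeFn_toLp⟩
  have hsub : tsupport (W n) ⊆ tsupport (mollifier e n) + tsupport w :=
    closure_minimal ((support_convolution_subset _).trans
      (add_subset_add (subset_tsupport _) (subset_tsupport _)))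
      ((hasCompactSupport_mollifier e n).isCompact.add hc).isClosed
  refine hsub.trans ?_
  rintro _ ⟨y, hy, x, hx, rfl⟩
  rw [tsupport_mollifier] at hy
  exact hn y hy x hx

/-! ### Reflection and folding. -/

/-- The linear reflection `(x₀, x₁) ↦ (-x₀, x₁)`. -/
def flipFirst : Plane ≃ₗᵢ[ℝ] Plane :=
  LinearIsometryEquiv.piLpCongrRight 2 fun i : Fin 2 =>
    if i = 0 then LinearIsometryEquiv.neg ℝ else LinearIsometryEquiv.refl ℝ ℝ

@[simp]
theorem flipFirst_zero (x : Plane) : flipFirst x 0 = -x 0 := by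
  simp [flipFirst]

@[simp]
theorem flipFirst_one (x : Plane) : flipFirst x 1 = x 1 := by
  simp [flipFirst]

theorem inner_flipFirst (x y : Plane) : ⟪flipFirst x, y⟫_ℝ = ⟪x, flipFirst y⟫_ℝ := by
  simp [PiLp.inner_apply, Fin.sum_univ_two]

/-- The reflection in the line `x₀ = a`. -/
def mirror (a : ℝ) (x : Plane) : Plane := flipFirst x + EuclideanSpace.single 0 (2 * a)

@[simp]
theorem mirror_zero (a : ℝ) (x : Plane) : mirror a x 0 = 2 * a - x 0 := by
  simp [mirror]; ring

@[simp]
theorem mirror_one (a : ℝ) (x : Plane) : mirror a x 1 = x 1 := by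
  simp [mirror]

theorem mirror_mirror (a : ℝ) (x : Plane) : mirror a (mirror a x) = x := by
  ext i
  fin_cases i <;> simp

theorem contDiff_mirror (a : ℝ) : ContDiff ℝ ∞ (mirror a) :=
  flipFirst.contDiff.add contDiff_const

theorem dist_mirror (a : ℝ) (x y : Plane) : dist (mirror a x) (mirror a y) = dist x y := by
  simp [mirror]

theorem measurePreserving_mirror (a : ℝ) : MeasurePreserving (mirror a) volume volume :=
  (measurePreserving_add_right volume _).comp flipFirst.measurePreserving

theorem gradient_comp_mirror {φ : Plane → ℝ} (hφ : Differentiable ℝ φ) (a : ℝ) (x : Plane) :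
    ∇ (φ ∘ mirror a) x = flipFirst (∇ φ (mirror a x)) := by
  have hm : HasFDerivAt (mirror a) (flipFirst : Plane →L[ℝ] Plane) x :=
    flipFirst.toContinuousLinearEquiv.hasFDerivAt.add_const _
  have h := (hφ (mirror a x)).hasFDerivAt.comp x hm
  refine ext_inner_right ℝ fun y => ?_
  rw [← InnerProductSpace.toDual_apply_apply (𝕜 := ℝ), toDual_gradient, h.fderiv, inner_flipFirst,
    ← InnerProductSpace.toDual_apply_apply (𝕜 := ℝ), toDual_gradient]
  rfl

theorem volume_vertical_line (a : ℝ) : volume {x : Plane | x 0 = a} = 0 := by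
  have h := (PiLp.volume_preserving_ofLp (Fin 2)).measure_preimage
    (s := {f : Fin 2 → ℝ | f 0 = a})
    (measurableSet_eq_fun (measurable_pi_apply 0) measurable_const).nullMeasurableSet
  have h' : volume {f : Fin 2 → ℝ | f 0 = a} = 0 :=
    Measure.pi_hyperplane (fun _ : Fin 2 => (volume : Measure ℝ)) 0 a
  rw [h'] at h
  exact h

theorem ae_first_ne (a : ℝ) : ∀ᵐ x : Plane, x 0 ≠ a :=
  measure_eq_zero_iff_ae_notMem.1 (volume_vertical_line a)

/-- The map that folds the plane along the line `x₀ = a` onto the half-plane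
`0 ≤ s * (x₀ - a)`. -/
def fold (s a : ℝ) (x : Plane) : Plane :=
  open scoped Classical in if 0 ≤ s * (x 0 - a) then x else mirror a x

theorem fold_of_nonneg {s a : ℝ} {x : Plane} (h : 0 ≤ s * (x 0 - a)) : fold s a x = x :=
  if_pos h

theorem fold_of_neg {s a : ℝ} {x : Plane} (h : s * (x 0 - a) < 0) : fold s a x = mirror a x :=
  if_neg h.not_ge

/-- Reflecting a point to the side of `x` can only bring it closer to `x`. -/
theorem lipschitzWith_fold {s : ℝ} (hs : s ≠ 0) (a : ℝ) : LipschitzWith 1 (fold s a) := by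
  have key (x y : Plane) (hx : 0 ≤ s * (x 0 - a)) (hy : s * (y 0 - a) < 0) :
      dist x (mirror a y) ≤ dist x y := by
    rw [EuclideanSpace.dist_eq, EuclideanSpace.dist_eq]
    refine Real.sqrt_le_sqrt ?_
    simp only [Fin.sum_univ_two, mirror_zero, mirror_one, Real.dist_eq, sq_abs]
    -- The two squared distances differ by `4 (x₀ - a) (y₀ - a)`, which is nonpositive for points on
    -- opposite sides.
    have h : (s * (x 0 - a)) * (s * (y 0 - a)) ≤ 0 := mul_nonpos_of_nonneg_of_nonpos hx hy.le
    have h' : (x 0 - a) * (y 0 - a) ≤ 0 := by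
      by_contra! h0
      have := mul_pos (sq_pos_of_ne_zero hs) h0
      nlinarith
    nlinarith
  refine LipschitzWith.of_dist_le_mul fun x y => ?_
  rw [NNReal.coe_one, one_mul]
  rcases le_or_gt 0 (s * (x 0 - a)) with hx | hx <;> rcases le_or_gt 0 (s * (y 0 - a)) with hy | hy
  · rw [fold_of_nonneg hx, fold_of_nonneg hy]
  · rw [fold_of_nonneg hx, fold_of_neg hy]
    exact key x y hx hy
  · rw [fold_of_neg hx, fold_of_nonneg hy, dist_comm, dist_comm x]
    exact key y x hy hx
  · rw [fold_of_neg hx, fold_of_neg hy, dist_mirror]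

theorem isCompact_fold_preimage {s : ℝ} (hs : s ≠ 0) (a : ℝ) {K : Set Plane} (hK : IsCompact K) :
    IsCompact (fold s a ⁻¹' K) := by
  refine (hK.union (hK.image (contDiff_mirror a).continuous)).of_isClosed_subset
    (hK.isClosed.preimage (lipschitzWith_fold hs a).continuous) fun x hx => ?_
  rcases le_or_gt 0 (s * (x 0 - a)) with h | h
  · rw [mem_preimage, fold_of_nonneg h] at hx
    exact .inl hx
  · rw [mem_preimage, fold_of_neg h] at hx
    exact .inr ⟨_, hx, mirror_mirror a x⟩

/-- The open half-plane `0 < s * (x₀ - a)`. -/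
def halfPlane (s a : ℝ) : Opens Plane where
  carrier := {x | 0 < s * (x 0 - a)}
  is_open' := isOpen_lt continuous_const (by fun_prop)

theorem mem_halfPlane {s a : ℝ} {x : Plane} :
    x ∈ (halfPlane s a : Set Plane) ↔ 0 < s * (x 0 - a) := Iff.rfl

theorem mirror_mem_halfPlane {s a : ℝ} {x : Plane} :
    mirror a x ∈ (halfPlane s a : Set Plane) ↔ s * (x 0 - a) < 0 := by
  rw [mem_halfPlane, mirror_zero]
  constructor <;> intro h <;> linarith

theorem fold_eventuallyEq_id {s a : ℝ} {x : Plane} (h : 0 < s * (x 0 - a)) :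
    fold s a =ᶠ[𝓝 x] id := by
  filter_upwards [(halfPlane s a).isOpen.mem_nhds h] with y hy
  exact fold_of_nonneg (mem_halfPlane.1 hy).le

theorem fold_eventuallyEq_mirror {s a : ℝ} {x : Plane} (h : s * (x 0 - a) < 0) :
    fold s a =ᶠ[𝓝 x] mirror a := by
  have ho : IsOpen {y : Plane | s * (y 0 - a) < 0} := isOpen_lt (by fun_prop) continuous_const
  filter_upwards [ho.mem_nhds h] with y hy
  exact fold_of_neg hy

theorem gradient_eventuallyEq {f g : Plane → ℝ} {x : Plane} (h : f =ᶠ[𝓝 x] g) :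
    ∇ f =ᶠ[𝓝 x] ∇ g := by
  filter_upwards [h.fderiv (𝕜 := ℝ)] with y hy
  simp only [gradient, hy]

theorem continuousAt_gradient_of_eventuallyEq {f g : Plane → ℝ} {x : Plane} (h : f =ᶠ[𝓝 x] g)
    (hg : ContDiff ℝ ∞ g) : ContinuousAt (∇ f) x :=
  (continuous_gradient hg).continuousAt.congr (gradient_eventuallyEq h).symm

/-- The kink of `φ ∘ fold s a` is confined to the fold line. This yields differentiability and
continuity of the gradient almost everywhere. -/
theorem exists_contDiff_eventuallyEq_comp_fold {s a : ℝ} (hs : s ≠ 0) {φ : Plane → ℝ}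
    (hφ : ContDiff ℝ ∞ φ) {x : Plane} (hx : x 0 ≠ a) :
    ∃ f : Plane → ℝ, ContDiff ℝ ∞ f ∧ φ ∘ fold s a =ᶠ[𝓝 x] f := by
  rcases (mul_ne_zero hs (sub_ne_zero.2 hx)).lt_or_gt with h | h
  · exact ⟨φ ∘ mirror a, hφ.comp (contDiff_mirror a), (fold_eventuallyEq_mirror h).fun_comp φ⟩
  · exact ⟨φ, hφ, (fold_eventuallyEq_id h).fun_comp φ⟩

/-! ### Folding of pairs in `L²`. -/

section

variable (s a : ℝ) (F : Type) [NormedAddCommGroup F] [NormedSpace ℝ F]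

/-- Multiplication by the indicator function of the half-plane `0 < s * (x₀ - a)`. -/
def restrictSide : Lp F 2 (volume : Measure Plane) →L[ℝ] Lp F 2 (volume : Measure Plane) :=
  (extendLTwo (halfPlane s a) F).toContinuousLinearMap ∘L
    LpToLpRestrictCLM Plane F ℝ volume 2 (halfPlane s a : Set Plane)

variable {F}

theorem restrictSide_ae {u : Lp F 2 (volume : Measure Plane)} {f : Plane → F}
    (h : u =ᵐ[volume] f) :
    restrictSide s a F u =ᵐ[volume] (halfPlane s a : Set Plane).indicator f := by
  have h1 := (ae_restrict_iff' (halfPlane s a).isOpen.measurableSet).1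
    (LpToLpRestrictCLM_coeFn (p := 2) ℝ (halfPlane s a : Set Plane) u)
  filter_upwards [h, h1, coeFn_extendLTwo (U := halfPlane s a)
    (LpToLpRestrictCLM Plane F ℝ volume 2 (halfPlane s a : Set Plane) u)] with x hx hx1 hx2
  refine hx2.trans ?_
  by_cases hxU : x ∈ (halfPlane s a : Set Plane)
  · rw [indicator_of_mem hxU, indicator_of_mem hxU, hx1 hxU, hx]
  · rw [indicator_of_notMem hxU, indicator_of_notMem hxU]

theorem restrictSide_comp_mirror_ae {u : Lp F 2 (volume : Measure Plane)} {f : Plane → F}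
    (h : u =ᵐ[volume] f) :
    Lp.compMeasurePreserving (mirror a) (measurePreserving_mirror a) (restrictSide s a F u)
      =ᵐ[volume] (halfPlane s a : Set Plane).indicator f ∘ mirror a :=
  (Lp.coeFn_compMeasurePreserving _ _).trans
    ((measurePreserving_mirror a).quasiMeasurePreserving.ae_eq_comp (restrictSide_ae s a h))

end

/-- Composition with `fold s a` at the level of pairs (function, gradient). -/
def foldPair (s a : ℝ) (p : LTwoPair) : LTwoPair :=
  WithLp.toLp 2
    (restrictSide s a ℝ p.fst + Lp.compMeasurePreserving (mirror a) (measurePreserving_mirror a)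
      (restrictSide s a ℝ p.fst),
    restrictSide s a Plane p.snd +
      (flipFirst : Plane →L[ℝ] Plane).compLp (Lp.compMeasurePreserving (mirror a)
        (measurePreserving_mirror a) (restrictSide s a Plane p.snd)))

theorem continuous_foldPair (s a : ℝ) : Continuous (foldPair s a) := by
  have h1 : Continuous fun p : LTwoPair => restrictSide s a ℝ p.fst :=
    (restrictSide s a ℝ).continuous.comp (WithLp.prod_continuous_ofLp 2 _ _).fst
  have h2 : Continuous fun p : LTwoPair => restrictSide s a Plane p.snd :=
    (restrictSide s a Plane).continuous.comp (WithLp.prod_continuous_ofLp 2 _ _).snd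
  have hm {F : Type} [NormedAddCommGroup F] :
      Continuous (Lp.compMeasurePreserving (E := F) (p := 2) (mirror a)
        (measurePreserving_mirror a)) :=
    (Lp.isometry_compMeasurePreserving (measurePreserving_mirror a)).continuous
  exact (WithLp.prod_continuous_toLp 2 _ _).comp ((h1.add (hm.comp h1)).prodMk
    (h2.add (((flipFirst : Plane →L[ℝ] Plane).compLpL 2 volume).continuous.comp (hm.comp h2))))

section

variable {s a : ℝ} {φ : Plane → ℝ} {p : LTwoPair}

theorem fst_foldPair_ae (hs : s ≠ 0) (hp : p.fst =ᵐ[volume] φ) :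
    (foldPair s a p).fst =ᵐ[volume] φ ∘ fold s a := by
  filter_upwards [Lp.coeFn_add (restrictSide s a ℝ p.fst) (Lp.compMeasurePreserving (mirror a)
    (measurePreserving_mirror a) (restrictSide s a ℝ p.fst)), restrictSide_ae s a hp,
    restrictSide_comp_mirror_ae s a hp, ae_first_ne a] with x h1 h2 h3 hx
  refine h1.trans ?_
  rw [Pi.add_apply, h2, h3, Function.comp_apply, Function.comp_apply]
  rcases (mul_ne_zero hs (sub_ne_zero.2 hx)).lt_or_gt with h | h
  · rw [indicator_of_notMem (mt mem_halfPlane.1 h.not_gt),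
      indicator_of_mem (mirror_mem_halfPlane.2 h), fold_of_neg h, zero_add]
  · rw [indicator_of_mem (mem_halfPlane.2 h),
      indicator_of_notMem (mt mirror_mem_halfPlane.1 h.not_gt), fold_of_nonneg h.le, add_zero]

/-- Off the fold line this is the chain rule on each side; the reflection is self-adjoint, so it
acts on the gradient as `flipFirst`. -/
theorem snd_foldPair_ae (hs : s ≠ 0) (hφ : ContDiff ℝ ∞ φ) (hp : p.snd =ᵐ[volume] ∇ φ) :
    (foldPair s a p).snd =ᵐ[volume] ∇ (φ ∘ fold s a) := by
  filter_upwards [Lp.coeFn_add (restrictSide s a Plane p.snd)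
    ((flipFirst : Plane →L[ℝ] Plane).compLp (Lp.compMeasurePreserving (mirror a)
    (measurePreserving_mirror a) (restrictSide s a Plane p.snd))), restrictSide_ae s a hp,
    ContinuousLinearMap.coeFn_compLp (flipFirst : Plane →L[ℝ] Plane)
      (Lp.compMeasurePreserving (mirror a) (measurePreserving_mirror a)
        (restrictSide s a Plane p.snd)),
    restrictSide_comp_mirror_ae s a hp, ae_first_ne a] with x h1 h2 h3 h4 hx
  refine h1.trans ?_
  rw [Pi.add_apply, h2, h3, h4, Function.comp_apply]
  rcases (mul_ne_zero hs (sub_ne_zero.2 hx)).lt_or_gt with h | h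
  · rw [indicator_of_notMem (mt mem_halfPlane.1 h.not_gt),
      indicator_of_mem (mirror_mem_halfPlane.2 h), zero_add,
      (gradient_eventuallyEq ((fold_eventuallyEq_mirror h).fun_comp φ)).eq_of_nhds]
    exact (gradient_comp_mirror (hφ.differentiable (by simp)) a x).symm
  · rw [indicator_of_mem (mem_halfPlane.2 h),
      indicator_of_notMem (mt mirror_mem_halfPlane.1 h.not_gt), map_zero, add_zero,
      (gradient_eventuallyEq ((fold_eventuallyEq_id h).fun_comp φ)).eq_of_nhds]
    rfl

theorem lipschitzWith_comp_fold (hs : s ≠ 0) {C : ℝ≥0} (hφ : LipschitzWith C φ) :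
    LipschitzWith C (φ ∘ fold s a) := by
  simpa using hφ.comp (lipschitzWith_fold hs a)

theorem tsupport_comp_fold_subset (hs : s ≠ 0) :
    tsupport (φ ∘ fold s a) ⊆ fold s a ⁻¹' tsupport φ :=
  closure_minimal (fun _ hx => subset_tsupport φ hx)
    ((isClosed_tsupport φ).preimage (lipschitzWith_fold hs a).continuous)

theorem hasCompactSupport_comp_fold (hs : s ≠ 0) (hc : HasCompactSupport φ) :
    HasCompactSupport (φ ∘ fold s a) :=
  (isCompact_fold_preimage hs a hc).of_isClosed_subset (isClosed_tsupport _)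
    (tsupport_comp_fold_subset hs)

/-! ### The two terms of the splitting. -/

theorem foldPair_mem (hs : s ≠ 0) {Ω A : Opens Plane} (hA : ∀ x, fold s a x ∈ Ω → x ∈ A)
    (hp : p ∈ testPairs Ω) : foldPair s a p ∈ closure (testPairs A) := by
  obtain ⟨φ, hφ, hc, hsub, hp1, hp2⟩ := hp
  obtain ⟨C, hC⟩ := ContDiff.lipschitzWith_of_hasCompactSupport hc hφ (by simp)
  have hKA : tsupport (φ ∘ fold s a) ⊆ A := fun x hx =>
    hA x (hsub (tsupport_comp_fold_subset hs hx))
  have hK := hasCompactSupport_comp_fold (a := a) hs hc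
  obtain ⟨ε, hε, hεA⟩ := hK.isCompact.exists_thickening_subset_open A.isOpen hKA
  -- The support is a compact subset of `A`, so unshifted mollifiers (`e = 0`) suffice.
  refine mem_closure_testPairs_of_lipschitz (lipschitzWith_comp_fold hs hC) hK ?_ 0 ?_
    (fst_foldPair_ae hs hp1) (snd_foldPair_ae hs hφ hp2)
  · filter_upwards [ae_first_ne a] with x hx
    obtain ⟨f, hf, hfe⟩ := exists_contDiff_eventuallyEq_comp_fold hs hφ hx
    exact continuousAt_gradient_of_eventuallyEq hfe hf
  · filter_upwards [Ioo_mem_nhdsGT hε] with δ hδ y hy x hx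
    refine hεA (Metric.mem_thickening_iff.2 ⟨x, hx, ?_⟩)
    rw [smul_zero, mem_closedBall_zero_iff] at hy
    simpa using hy.trans_lt hδ.2

/-- The difference vanishes on the kept side, but its support may reach the fold line, which need
not lie in `B`. A small shift across the line, within `Ω`, brings the support into `B`. -/
theorem sub_foldPair_mem (hs : |s| = 1) {Ω B : Opens Plane}
    (hΩ : ∀ x, fold s a x ∈ Ω → x ∈ Ω) (hB : ∀ x ∈ Ω, s * (x 0 - a) < 0 → x ∈ B)
    (hp : p ∈ testPairs Ω) : p - foldPair s a p ∈ closure (testPairs B) := by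
  obtain ⟨φ, hφ, hc, hsub, hp1, hp2⟩ := hp
  have hs0 : s ≠ 0 := by
    rintro rfl
    simp at hs
  have hss : s * s = 1 := by rw [← abs_mul_abs_self, hs, one_mul]
  obtain ⟨C, hC⟩ := ContDiff.lipschitzWith_of_hasCompactSupport hc hφ (by simp)
  have hK : HasCompactSupport (φ - φ ∘ fold s a) := hc.sub (hasCompactSupport_comp_fold hs0 hc)
  have hKΩ : tsupport (φ - φ ∘ fold s a) ⊆ Ω := by
    refine (tsupport_sub _ _).trans (union_subset hsub fun x hx => ?_)
    exact hΩ x (hsub (tsupport_comp_fold_subset hs0 hx))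
  have hside : tsupport (φ - φ ∘ fold s a) ⊆ {x | s * (x 0 - a) ≤ 0} := by
    refine closure_minimal (fun x hx => ?_) (isClosed_le (by fun_prop) continuous_const)
    by_contra h
    refine hx ?_
    rw [Pi.sub_apply, Function.comp_apply, fold_of_nonneg (not_le.1 h).le, sub_self]
  obtain ⟨ε, hε, hεΩ⟩ := hK.isCompact.exists_thickening_subset_open Ω.isOpen hKΩ
  refine mem_closure_testPairs_of_lipschitz (hC.sub (lipschitzWith_comp_fold hs0 hC)) hK ?_
    -- For `y` in the ball of radius `δ` around `δ • e`, the factor `2` gives `s * y 0 ≤ -δ < 0`, so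
    -- the shift ends strictly beyond the line.
    (EuclideanSpace.single 0 (-2 * s)) ?_ ?_ ?_
  · filter_upwards [ae_first_ne a] with x hx
    obtain ⟨f, hf, hfe⟩ := exists_contDiff_eventuallyEq_comp_fold hs0 hφ hx
    exact continuousAt_gradient_of_eventuallyEq ((EventuallyEq.refl _ φ).sub hfe) (hφ.sub hf)
  -- Such a `y` has norm at most `2δ + δ = 3δ`, hence the bound `ε / 3`.
  · filter_upwards [Ioo_mem_nhdsGT (by positivity : 0 < ε / 3)] with δ hδ y hy x hx
    rw [mem_closedBall_iff_norm] at hy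
    have h0 : |y 0 + 2 * s * δ| ≤ δ := by
      have := (PiLp.norm_apply_le (y - δ • EuclideanSpace.single 0 (-2 * s)) 0).trans hy
      simpa [Real.norm_eq_abs, mul_comm, mul_left_comm] using this
    have hy' : ‖y‖ < ε := by
      have h1 := norm_le_norm_add_norm_sub' y (δ • EuclideanSpace.single 0 (-2 * s))
      have h2 : ‖δ • (EuclideanSpace.single 0 (-2 * s) : Plane)‖ = δ * 2 := by
        rw [norm_smul, PiLp.norm_single, Real.norm_of_nonneg hδ.1.le, norm_mul,
          Real.norm_eq_abs s, hs]
        norm_num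
      linarith [hδ.2]
    refine hB _ (hεΩ (Metric.mem_thickening_iff.2 ⟨x, hx, by simpa using hy'⟩)) ?_
    have h3 : s * (y 0 + 2 * s * δ) ≤ δ := by
      refine (le_abs_self _).trans ?_
      rwa [abs_mul, hs, one_mul]
    have h4 : s * (x 0 - a) ≤ 0 := hside hx
    have h5 : s * (y 0 + 2 * s * δ) = s * y 0 + 2 * δ := by linear_combination 2 * δ * hss
    have h6 : s * ((y + x) 0 - a) = s * y 0 + s * (x 0 - a) := by
      rw [PiLp.add_apply]; ring
    rw [h6]
    linarith [hδ.1]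
  · exact (Lp.coeFn_sub _ _).trans (hp1.sub (fst_foldPair_ae hs0 hp1))
  · refine (Lp.coeFn_sub _ _).trans ?_
    filter_upwards [hp2, snd_foldPair_ae (a := a) hs0 hφ hp2, ae_first_ne a] with x h1 h2 hx
    obtain ⟨f, hf, hfe⟩ := exists_contDiff_eventuallyEq_comp_fold (s := s) hs0 hφ hx
    have hd : DifferentiableAt ℝ (φ ∘ fold s a) x :=
      (hf.differentiable (by simp) x).congr_of_eventuallyEq hfe
    change p.snd x - (foldPair s a p).snd x = _
    rw [h1, h2]
    simp only [gradient]
    rw [fderiv_fun_sub (hφ.differentiable (by simp) x) hd, map_sub]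

end

/-- Both `foldPair` and its difference from the identity are continuous and send test pairs into
closed sets, so the splitting extends to the closure. -/
theorem exists_split_of_fold {s a : ℝ} (hs : |s| = 1) {Ω A B : Opens Plane}
    (hA : ∀ x, fold s a x ∈ Ω → x ∈ A) (hAΩ : A ≤ Ω)
    (hB : ∀ x ∈ Ω, s * (x 0 - a) < 0 → x ∈ B) {p : LTwoPair} (hp : p ∈ closure (testPairs Ω)) :
    ∃ q ∈ closure (testPairs A), ∃ r ∈ closure (testPairs B), p = q + r := by
  have hs0 : s ≠ 0 := by
    rintro rfl
    simp at hs
  refine ⟨foldPair s a p, ?_, p - foldPair s a p, ?_, by abel⟩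
  · exact closure_minimal (fun q hq => foldPair_mem hs0 hA hq)
      (isClosed_closure.preimage (continuous_foldPair s a)) hp
  · exact closure_minimal (fun q hq => sub_foldPair_mem hs (fun x hx => hAΩ (hA x hx)) hB hq)
      (isClosed_closure.preimage (continuous_id.sub (continuous_foldPair s a))) hp

/-! ### Geometry of the two domains. -/

theorem lShape_eq_sup : lShape = lShapeOne ⊔ lShapeTwo := by
  ext x
  change (x 0 ∈ Ioo (-1) 1 ∧ x 1 ∈ Ioo (-1) 1) ∧ ¬(x 0 ∈ Icc (-1) 0 ∧ x 1 ∈ Icc (-1) 0) ↔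
    (x 0 ∈ Ioo (-1) 1 ∧ x 1 ∈ Ioo 0 1) ∨ (x 0 ∈ Ioo 0 1 ∧ x 1 ∈ Ioo (-1) 1)
  simp only [mem_Ioo, mem_Icc]
  grind

/-- The kept side is `x₀ ≤ 0`, which the vertical rectangle does not meet, and the horizontal
rectangle is symmetric in `x₀ = 0`. -/
theorem fold_mem_lShape {x : Plane} (h : fold (-1) 0 x ∈ lShape) : x ∈ lShapeOne := by
  rw [lShape_eq_sup] at h
  change (fold (-1) 0 x 0 ∈ Ioo (-1) 1 ∧ fold (-1) 0 x 1 ∈ Ioo 0 1) ∨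
    (fold (-1) 0 x 0 ∈ Ioo 0 1 ∧ fold (-1) 0 x 1 ∈ Ioo (-1) 1) at h
  change x 0 ∈ Ioo (-1) 1 ∧ x 1 ∈ Ioo 0 1
  simp only [mem_Ioo] at h ⊢
  rcases le_or_gt 0 (-1 * (x 0 - 0)) with hx | hx
  · rw [fold_of_nonneg hx] at h
    rcases h with h | h
    · exact h
    · linarith [h.1.1]
  · rw [fold_of_neg hx, mirror_zero, mirror_one] at h
    rcases h with h | h
    · exact ⟨⟨by linarith, by linarith [h.1.1]⟩, h.2⟩
    · linarith [h.1.1]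

theorem mem_lShapeTwo {x : Plane} (h : x ∈ lShape) (hx : -1 * (x 0 - 0) < 0) : x ∈ lShapeTwo := by
  obtain ⟨⟨h0, h1⟩, -⟩ := h
  exact ⟨⟨by linarith, h0.2⟩, h1⟩

/-- The kept side is `x₀ ≥ 1`, which the square `(-1, 1)²` does not meet, and the rotated square is
symmetric in `x₀ = 1`. -/
theorem fold_mem_pentagon {x : Plane} (h : fold 1 1 x ∈ pentagon) : x ∈ pentagonTwo := by
  change (fold 1 1 x 0 ∈ Ioo (-1) 1 ∧ fold 1 1 x 1 ∈ Ioo (-1) 1) ∨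
    |fold 1 1 x 0 - 1| + |fold 1 1 x 1| < 1 at h
  change |x 0 - 1| + |x 1| < 1
  simp only [mem_Ioo] at h
  rcases le_or_gt 0 (1 * (x 0 - 1)) with hx | hx
  · rw [fold_of_nonneg hx] at h
    rcases h with h | h
    · linarith [h.1.2]
    · exact h
  · rw [fold_of_neg hx, mirror_zero, mirror_one] at h
    rcases h with h | h
    · linarith [h.1.2]
    · rwa [show 2 * 1 - x 0 - 1 = -(x 0 - 1) by ring, abs_neg] at h

theorem mem_pentagonOne {x : Plane} (h : x ∈ pentagon) (hx : 1 * (x 0 - 1) < 0) :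
    x ∈ pentagonOne := by
  rcases h with h | h
  · exact h
  · change |x 0 - 1| + |x 1| < 1 at h
    change x 0 ∈ Ioo (-1) 1 ∧ x 1 ∈ Ioo (-1) 1
    have h0 := neg_abs_le (x 0 - 1)
    have h0' := abs_nonneg (x 0 - 1)
    have h1 := abs_nonneg (x 1)
    exact ⟨⟨by linarith, by linarith⟩, abs_lt.1 (by linarith)⟩

end

theorem mainTheorem2 (Ω Ω₁ Ω₂ : Opens Plane)
    (hΩ : (Ω = lShape ∧ Ω₁ = lShapeOne ∧ Ω₂ = lShapeTwo) ∨
      (Ω = pentagon ∧ Ω₁ = pentagonOne ∧ Ω₂ = pentagonTwo)) :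
    Ω = Ω₁ ⊔ Ω₂ ∧
    (∀ v : SobolevH10 Ω, ∃ v₁ : SobolevH10 Ω₁, ∃ v₂ : SobolevH10 Ω₂,
      zeroExtension v =ᵐ[volume] zeroExtension v₁ + zeroExtension v₂) ∧
    IsDecomposingFamily (H := SobolevH10 Ω) (fun i : Fin 2 => extendedH10 Ω (![Ω₁, Ω₂] i)) := by
  have hsup : Ω = Ω₁ ⊔ Ω₂ := by
    rcases hΩ with ⟨rfl, rfl, rfl⟩ | ⟨rfl, rfl, rfl⟩
    · exact lShape_eq_sup
    · rfl
  have h₁ : Ω₁ ≤ Ω := hsup ▸ le_sup_left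
  have h₂ : Ω₂ ≤ Ω := hsup ▸ le_sup_right
  refine ⟨hsup, decomposition_of_split h₁ h₂ fun p hp => ?_⟩
  rcases hΩ with ⟨rfl, rfl, rfl⟩ | ⟨rfl, rfl, rfl⟩
  · exact exists_split_of_fold (s := -1) (a := 0) (by simp) (fun x => fold_mem_lShape) h₁
      (fun x => mem_lShapeTwo) hp
  -- Here the folded term lies in the second piece, so the summands are exchanged at the end.
  · obtain ⟨q, hq, r, hr, e⟩ := exists_split_of_fold (s := 1) (a := 1) (by simp)
      (fun x => fold_mem_pentagon) h₂ (fun x => mem_pentagonOne) hp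
    exact ⟨r, hr, q, hq, e.trans (add_comm q r)⟩
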